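/- Let $t_2$, $t_3$, $\lambda$ and $k$ be positive integers such that $k-\lambda>2$, $5\nmid\lambda$ and $$2t_2+3t_3=\frac{k(k-1)-2}{\lambda}+1 .$$ A $(v,k,\lambda)$-covering consists of a set $V$ of $v$ points and a finite collection $\mathcal B$ of $k$-subsets of $V$, called blocks (repeated blocks are allowed), such that every pair of distinct points lies in at least $\lambda$ blocks; it is symmetric if it has exactly $v$ blocks. Its excess is the multigraph on $V$ in which distinct points $x$ and $y$ are joined by $r_{xy}-\lambda$ edges, where $r_{xy}$ is the number of blocks containing both $x$ and $y$. A $2$-cycle is a pair of parallel edges. There does not exist a symmetric $(2t_2+3t_3,k,\lambda)$-covering whose excess is the vertex-disjoint union of $t_2$ cycles of length $2$ and $t_3$ cycles of length $3$ if, for some odd positive integer $\alpha$ and some integer $s$ with $5\nmid s$, one of the following holds: (i) $k-\lambda=5^\alpha s+1$ and $t_3$ is odd; (ii) $k-\lambda=5^\alpha s+2$, $t_2$ is odd and $\lambda\equiv 1$ or $4\pmod 5$; (iii) $k-\lambda=5^\alpha s-2$, $t_2+t_3$ is odd and $\lambda\equiv 1$ or $4\pmod 5$. -/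

import Mathlib

/-- A loopless multigraph with vertex set `V`: `mult x y` is the multiplicity of the edge `xy`. -/
structure LooplessMultigraph (V : Type*) where
  mult : V → V → ℕ
  symm : ∀ x y, mult x y = mult y x
  loopless : ∀ x, mult x x = 0

namespace LooplessMultigraph

/-- Edge multiplicities of the cycle `0, 1, …, n - 1, 0` of length `n ≥ 2`. A pair `a ≠ b` gets one
edge for each of `b = a + 1` and `a = b + 1` (modulo `n`) that holds, so that the cycle of
length `2` is a pair of parallel edges. -/
def cycleMult (n a b : ℕ) : ℕ :=
  if a = b then 0 else (if (a + 1) % n = b then 1 else 0) + (if (b + 1) % n = a then 1 else 0)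

theorem cycleMult_comm (n a b : ℕ) : cycleMult n a b = cycleMult n b a := by
  unfold cycleMult
  by_cases h : a = b
  · simp [h]
  · rw [if_neg h, if_neg (Ne.symm h), add_comm]

/-- The vertex-disjoint union of cycles of lengths `c i`, for `i : I`. -/
def disjointCycles {I : Type*} [DecidableEq I] (c : I → ℕ) :
    LooplessMultigraph (Σ i, Fin (c i)) where
  mult x y := if x.1 = y.1 then cycleMult (c x.1) x.2 y.2 else 0
  symm := by
    rintro ⟨i, a⟩ ⟨j, b⟩
    by_cases h : i = j
    · subst h
      simp [cycleMult_comm]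
    · simp [h, Ne.symm h]
  loopless x := by simp [cycleMult]

/-- `G` is a vertex-disjoint union of cycles of lengths `c i ≥ 2`, for `i : I`, which together
contain all vertices of `G`. -/
def ConsistsOfCycles {V I : Type*} [DecidableEq I] (G : LooplessMultigraph V) (c : I → ℕ) : Prop :=
  (∀ i, 2 ≤ c i) ∧
    ∃ e : V ≃ (Σ i, Fin (c i)), ∀ x y, G.mult x y = (disjointCycles c).mult (e x) (e y)

end LooplessMultigraph

/-- A `(v, k, lam)`-covering with point set `V`. Its blocks form a family indexed by `β`, so that
repeated blocks are allowed. -/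
structure BlockCovering (v k lam : ℕ) (V β : Type*) [Fintype V] [DecidableEq V] [Fintype β] where
  block : β → Finset V
  card_points : Fintype.card V = v
  card_block : ∀ j, (block j).card = k
  covers : ∀ x y, x ≠ y → lam ≤ (Finset.univ.filter fun j => x ∈ block j ∧ y ∈ block j).card

namespace BlockCovering

variable {v k lam : ℕ} {V β : Type*} [Fintype V] [DecidableEq V] [Fintype β]

/-- The number of blocks that contain both `x` and `y`. -/
def pairCount (C : BlockCovering v k lam V β) (x y : V) : ℕ :=
  (Finset.univ.filter fun j => x ∈ C.block j ∧ y ∈ C.block j).card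

/-- A covering is symmetric if it has as many blocks as points. -/
def IsSymmetric (_C : BlockCovering v k lam V β) : Prop :=
  Fintype.card β = Fintype.card V

/-- The excess: distinct points `x` and `y` are joined by `r - lam` edges, where `r ≥ lam` is the
number of blocks that contain both. -/
def excess (C : BlockCovering v k lam V β) : LooplessMultigraph V where
  mult x y := if x = y then 0 else C.pairCount x y - lam
  symm x y := by
    by_cases h : x = y
    · simp [h]
    · simp [h, Ne.symm h, pairCount, and_comm]
  loopless x := by simp

end BlockCovering

theorem sum_mul_mul_eq_zero_of_isotropic {F J : Type*} [Field F] [Fintype J] (h2 : (2 : F) ≠ 0)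
    (w : J → F) (K : Submodule F (J → F)) (hK : ∀ x ∈ K, ∑ j, w j * x j ^ 2 = 0)
    {x y : J → F} (hx : x ∈ K) (hy : y ∈ K) : ∑ j, w j * (x j * y j) = 0 := by
  have h := hK _ (K.add_mem hx hy)
  have h1 : ∑ j, w j * (x + y) j ^ 2
      = ∑ j, w j * x j ^ 2 + ∑ j, w j * y j ^ 2 + 2 * ∑ j, w j * (x j * y j) := by
    rw [Finset.mul_sum, ← Finset.sum_add_distrib, ← Finset.sum_add_distrib]
    refine Finset.sum_congr rfl fun j _ => ?_
    simp only [Pi.add_apply]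
    ring
  rw [h1, hK x hx, hK y hy, zero_add, zero_add] at h
  exact (mul_eq_zero.mp h).resolve_left h2

open Module in
/-- A totally isotropic subspace has at most half the dimension of a nondegenerate form. -/
theorem two_mul_finrank_le_of_isotropic {F J : Type*} [Field F] [Fintype J] (h2 : (2 : F) ≠ 0)
    (w : J → F) (hw : ∀ j, w j ≠ 0) (K : Submodule F (J → F))
    (hK : ∀ x ∈ K, ∑ j, w j * x j ^ 2 = 0) : 2 * finrank F K ≤ Fintype.card J := by
  classical
  let B : LinearMap.BilinForm F (J → F) := Matrix.toBilin' (Matrix.diagonal w)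
  have hB : ∀ x y, B x y = ∑ j, w j * (x j * y j) := fun x y => by
    simp only [B, Matrix.toBilin'_apply', Matrix.mulVec_diagonal, dotProduct]
    exact Finset.sum_congr rfl fun j _ => by ring
  have hnd : B.Nondegenerate :=
    Matrix.Nondegenerate.toBilin' (Matrix.nondegenerate_of_det_ne_zero (by
      rw [Matrix.det_diagonal]
      exact Finset.prod_ne_zero_iff.mpr fun j _ => hw j))
  have hle : K ≤ B.orthogonal K := fun x hx y hy => by
    change B y x = 0
    rw [hB]
    exact sum_mul_mul_eq_zero_of_isotropic h2 w K hK hy hx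
  have h := LinearMap.BilinForm.finrank_orthogonal hnd K
  have h' := Submodule.finrank_mono hle
  have h'' := Submodule.finrank_le K
  rw [finrank_fintype_fun_eq_card] at h h''
  omega

theorem det_fromBlocks_zero_transpose {F m : Type*} [Field F] [Fintype m] [DecidableEq m]
    (B C : Matrix m m F) :
    (Matrix.fromBlocks 0 B B.transpose C).det = B.det ^ 2 ∨
      (Matrix.fromBlocks 0 B B.transpose C).det = -B.det ^ 2 := by
  have h1 : Matrix.fromBlocks 0 B B.transpose C * Matrix.fromBlocks 0 1 1 0
      = Matrix.fromBlocks B 0 C B.transpose := by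
    simp [Matrix.fromBlocks_multiply]
  have h2 : (Matrix.fromBlocks 0 1 1 0 : Matrix (m ⊕ m) (m ⊕ m) F) * Matrix.fromBlocks 0 1 1 0
      = 1 := by
    simp [Matrix.fromBlocks_multiply]
  have h3 := congrArg Matrix.det h1
  have h4 := congrArg Matrix.det h2
  rw [Matrix.det_mul, Matrix.det_fromBlocks_zero₁₂, Matrix.det_transpose] at h3
  rw [Matrix.det_mul, Matrix.det_one] at h4
  rcases mul_self_eq_one_iff.mp h4 with h | h <;> rw [h] at h3
  · left; linear_combination h3
  · right; linear_combination -h3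

open Module in
/-- A diagonal form with a totally isotropic subspace of half the dimension has a square
discriminant, up to sign. -/
theorem isSquare_prod_of_isotropic {F J : Type*} [Field F] [Fintype J] (h2 : (2 : F) ≠ 0)
    (w : J → F) (K : Submodule F (J → F)) (hK : ∀ x ∈ K, ∑ j, w j * x j ^ 2 = 0)
    (hdim : 2 * finrank F K = Fintype.card J) :
    IsSquare (∏ j, w j) ∨ IsSquare (-∏ j, w j) := by
  classical
  obtain ⟨K', hc⟩ := K.exists_isCompl
  have hK' : finrank F K' = finrank F K := by
    have := Submodule.finrank_add_eq_of_isCompl hc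
    rw [finrank_fintype_fun_eq_card] at this
    omega
  set m := finrank F K with hm
  let b₁ : Basis (Fin m) F K := finBasisOfFinrankEq F K hm.symm
  let b₂ : Basis (Fin m) F K' := finBasisOfFinrankEq F K' hK'
  let b : Basis (Fin m ⊕ Fin m) F (J → F) :=
    (b₁.prod b₂).map (K.prodEquivOfIsCompl K' hc)
  have hb : ∀ i, b (Sum.inl i) ∈ K := fun i => by
    simp [b]
  obtain ⟨σ⟩ : Nonempty (Fin m ⊕ Fin m ≃ J) := by
    apply Fintype.card_eq.mp
    simp only [Fintype.card_sum, Fintype.card_fin]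
    omega
  let T : Matrix (Fin m ⊕ Fin m) (Fin m ⊕ Fin m) F := fun i j => b i (σ j)
  have hT : T.det ≠ 0 := by
    have hli : LinearIndependent F T.row := by
      have := b.linearIndependent.map' (LinearEquiv.funCongrLeft F F σ).toLinearMap
        (LinearEquiv.ker _)
      exact this
    exact ((Matrix.isUnit_iff_isUnit_det T).mp
      (Matrix.linearIndependent_rows_iff_isUnit.mp hli)).ne_zero
  let G := T * Matrix.diagonal (w ∘ σ) * T.transpose
  have hG : ∀ i j, G i j = ∑ l, w l * (b i l * b j l) := fun i j => by
    rw [← σ.sum_comp]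
    simp only [G, Matrix.mul_apply (M := T * _)]
    refine Finset.sum_congr rfl fun l _ => ?_
    simp only [Matrix.mul_diagonal, Matrix.transpose_apply, Function.comp_apply]
    simp only [T]
    ring
  have hblocks : G = Matrix.fromBlocks 0 G.toBlocks₁₂ G.toBlocks₁₂.transpose G.toBlocks₂₂ := by
    ext i j
    rcases i with i | i <;> rcases j with j | j
    · simp only [Matrix.fromBlocks_apply₁₁, hG, Matrix.zero_apply]
      exact sum_mul_mul_eq_zero_of_isotropic h2 w K hK (hb i) (hb j)
    · rfl
    · simp only [Matrix.fromBlocks_apply₂₁, Matrix.transpose_apply, Matrix.toBlocks₁₂,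
        Matrix.of_apply, hG]
      exact Finset.sum_congr rfl fun l _ => by ring
    · rfl
  have hdet : G.det = T.det ^ 2 * ∏ j, w j := by
    simp only [G, Matrix.det_mul, Matrix.det_transpose, Matrix.det_diagonal, Function.comp_apply]
    rw [σ.prod_comp w]
    ring
  have h := det_fromBlocks_zero_transpose G.toBlocks₁₂ G.toBlocks₂₂
  rw [← hblocks, hdet] at h
  rcases h with h | h
  · refine Or.inl ⟨G.toBlocks₁₂.det / T.det, ?_⟩
    field_simp
    linear_combination h
  · refine Or.inr ⟨G.toBlocks₁₂.det / T.det, ?_⟩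
    field_simp
    linear_combination -h

open Module in
/-- Clearing denominators: the integral points of a rational subspace have full rank. -/
theorem finrank_le_finrank_integral_points {ι : Type*} [Fintype ι] (E : Submodule ℚ (ι → ℚ))
    (L : Submodule ℤ (ι → ℤ)) (hL : ∀ z : ι → ℤ, z ∈ L ↔ (fun i => (z i : ℚ)) ∈ E) :
    finrank ℚ E ≤ finrank ℤ L := by
  let b := finBasis ℚ E
  have hcl : ∀ x : ι → ℚ, ∃ d : ℤ, d ≠ 0 ∧ ∃ z : ι → ℤ, ∀ i, (z i : ℚ) = d * x i := fun x => by
    obtain ⟨d, hd⟩ := IsLocalization.exist_integer_multiples_of_finite (nonZeroDivisors ℤ) x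
    choose z hz using hd
    refine ⟨d, nonZeroDivisors.ne_zero d.2, z, fun i => ?_⟩
    have := hz i
    simpa [Submonoid.smul_def] using this
  choose d hd z hz using fun i => hcl (b i)
  have hmem : ∀ i, z i ∈ L := fun i => by
    rw [hL]
    have : (fun j => (z i j : ℚ)) = (d i : ℚ) • (b i : ι → ℚ) := by
      ext j
      simp [hz]
    rw [this]
    exact E.smul_mem _ (b i).2
  have hli : LinearIndependent ℤ fun i => (⟨z i, hmem i⟩ : L) := by
    rw [Fintype.linearIndependent_iff]
    intro g hg i
    have h1 : ∑ i, ((g i : ℚ) * d i) • b i = 0 := by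
      apply Subtype.ext
      ext j
      have h2 := congrArg (fun x : L => ((x : ι → ℤ) j : ℚ)) hg
      simp only [Submodule.coe_sum, Submodule.coe_smul, Finset.sum_apply, Pi.smul_apply,
        smul_eq_mul, Int.cast_sum, Int.cast_mul, hz] at h2
      simp only [Submodule.coe_sum, Submodule.coe_smul, Finset.sum_apply, Pi.smul_apply,
        smul_eq_mul, mul_assoc]
      simpa using h2
    have h3 := Fintype.linearIndependent_iff.mp b.linearIndependent _ h1 i
    have h4 : (d i : ℚ) ≠ 0 := by exact_mod_cast hd i
    exact_mod_cast (mul_eq_zero.mp h3).resolve_right h4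
  simpa using hli.fintype_card_le_finrank

open Module in
/-- The reduction modulo `p` of the integral points of a rational subspace has at least the
dimension of this subspace. -/
theorem finrank_le_finrank_reduction {ι : Type*} [Fintype ι] (p : ℕ) [Fact p.Prime]
    (E : Submodule ℚ (ι → ℚ)) (R : Submodule (ZMod p) (ι → ZMod p))
    (hR : ∀ z : ι → ℤ, (fun i => (z i : ℚ)) ∈ E → (fun i => (z i : ZMod p)) ∈ R) :
    finrank ℚ E ≤ finrank (ZMod p) R := by
  let c : (ι → ℤ) →ₗ[ℤ] (ι → ℚ) :=
    { toFun := fun z i => (z i : ℚ)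
      map_add' := fun x y => by ext; simp
      map_smul' := fun a x => by ext; simp }
  let L : Submodule ℤ (ι → ℤ) := (E.restrictScalars ℤ).comap c
  have hL : ∀ z : ι → ℤ, z ∈ L ↔ (fun i => (z i : ℚ)) ∈ E := fun z => Iff.rfl
  refine (finrank_le_finrank_integral_points E L hL).trans ?_
  let b := finBasis ℤ L
  have hp : (p : ℤ) ≠ 0 := by exact_mod_cast (Fact.out : p.Prime).ne_zero
  have hli : LinearIndependent (ZMod p)
      fun i => (⟨fun j => ((b i : ι → ℤ) j : ZMod p), hR _ ((hL _).mp (b i).2)⟩ : R) := by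
    rw [Fintype.linearIndependent_iff]
    intro g hg
    choose a ha using fun i => ZMod.intCast_surjective (g i)
    set x : L := ∑ i, a i • b i with hx
    have hdvd : ∀ j, (p : ℤ) ∣ (x : ι → ℤ) j := fun j => by
      rw [← ZMod.intCast_zmod_eq_zero_iff_dvd]
      have h2 := congrArg (fun y : R => (y : ι → ZMod p) j) hg
      simp only [Submodule.coe_sum, Submodule.coe_smul, Finset.sum_apply, Pi.smul_apply,
        smul_eq_mul, ← ha] at h2
      simp only [hx, Submodule.coe_sum, Submodule.coe_smul, Finset.sum_apply, Pi.smul_apply,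
        smul_eq_mul, Int.cast_sum, Int.cast_mul]
      simpa using h2
    choose y hy using hdvd
    have hyL : y ∈ L := by
      rw [hL]
      have h1 : (fun j => (y j : ℚ)) = ((p : ℚ)⁻¹) • fun j => ((x : ι → ℤ) j : ℚ) := by
        have hp' : (p : ℚ) ≠ 0 := by exact_mod_cast hp
        ext j
        simp only [hy, Pi.smul_apply, smul_eq_mul, Int.cast_mul, Int.cast_natCast]
        field_simp
      rw [h1]
      exact E.smul_mem _ ((hL _).mp x.2)
    have hxy : x = (p : ℤ) • (⟨y, hyL⟩ : L) := by
      apply Subtype.ext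
      ext j
      simp [hy]
    intro i
    have h3 : b.repr x i = a i := by
      rw [hx, b.repr_sum_self]
    rw [hxy, map_smul, Finsupp.smul_apply, smul_eq_mul] at h3
    rw [← ha i, ← h3]
    simp
  simpa using hli.fintype_card_le_finrank

open Module in
/-- The two residue forms of a rational diagonal form with a totally isotropic subspace `E` have
totally isotropic subspaces whose dimensions add up to at least that of `E`. -/
theorem exists_isotropic_residues {I J : Type*} [Fintype I] [Fintype J] (p : ℕ)
    [Fact p.Prime] (u : I → ℤ) (w : J → ℤ) (E : Submodule ℚ (I ⊕ J → ℚ))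
    (hE : ∀ x ∈ E, ∑ i, (u i : ℚ) * x (Sum.inl i) ^ 2
      + p * ∑ j, (w j : ℚ) * x (Sum.inr j) ^ 2 = 0) :
    ∃ (P : Submodule (ZMod p) (I → ZMod p)) (K : Submodule (ZMod p) (J → ZMod p)),
      (∀ x ∈ P, ∑ i, (u i : ZMod p) * x i ^ 2 = 0) ∧
      (∀ x ∈ K, ∑ j, (w j : ZMod p) * x j ^ 2 = 0) ∧
      finrank ℚ E ≤ finrank (ZMod p) P + finrank (ZMod p) K := by
  have hp : (p : ℤ) ≠ 0 := by exact_mod_cast (Fact.out : p.Prime).ne_zero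
  let A : AddSubgroup (I ⊕ J → ZMod p) :=
    { carrier := {x | ∃ z : I ⊕ J → ℤ, (fun i => (z i : ℚ)) ∈ E ∧ x = fun i => (z i : ZMod p)}
      zero_mem' := ⟨0, by simp only [Pi.zero_apply, Int.cast_zero]; exact E.zero_mem, by ext; simp⟩
      add_mem' := by
        rintro _ _ ⟨z, hz, rfl⟩ ⟨z', hz', rfl⟩
        exact ⟨z + z', by simpa [← Pi.add_def] using E.add_mem hz hz', by ext; simp⟩
      neg_mem' := by
        rintro _ ⟨z, hz, rfl⟩
        exact ⟨-z, by simpa [← Pi.neg_def] using hz, by ext; simp⟩ }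
  let R : Submodule (ZMod p) (I ⊕ J → ZMod p) := AddSubgroup.toZModSubmodule p A
  have hR : ∀ x, x ∈ R ↔
      ∃ z : I ⊕ J → ℤ, (fun i => (z i : ℚ)) ∈ E ∧ x = fun i => (z i : ZMod p) := fun x => Iff.rfl
  have hdim := finrank_le_finrank_reduction p E R fun z hz => (hR _).mpr ⟨z, hz, rfl⟩
  have hEz : ∀ z : I ⊕ J → ℤ, (fun i => (z i : ℚ)) ∈ E →
      ∑ i, u i * z (Sum.inl i) ^ 2 + p * ∑ j, w j * z (Sum.inr j) ^ 2 = 0 := fun z hz => by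
    have := hE _ hz
    exact_mod_cast this
  let f : R →ₗ[ZMod p] (I → ZMod p) :=
    (LinearMap.funLeft (ZMod p) (ZMod p) Sum.inl).comp R.subtype
  let g : LinearMap.ker f →ₗ[ZMod p] (J → ZMod p) :=
    ((LinearMap.funLeft (ZMod p) (ZMod p) Sum.inr).comp R.subtype).comp (LinearMap.ker f).subtype
  have hker : ∀ x : LinearMap.ker f, ∀ i, (x : I ⊕ J → ZMod p) (Sum.inl i) = 0 := fun x i =>
    congrFun (LinearMap.mem_ker.mp x.2) i
  have hg : Function.Injective g := by
    intro x y hxy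
    apply Subtype.ext
    apply Subtype.ext
    ext i
    rcases i with i | j
    · rw [hker x, hker y]
    · exact congrFun hxy j
  refine ⟨LinearMap.range f, LinearMap.range g, ?_, ?_, ?_⟩
  · rintro _ ⟨⟨x, hx⟩, rfl⟩
    obtain ⟨z, hz, rfl⟩ := (hR _).mp hx
    have h := congrArg (Int.cast : ℤ → ZMod p) (hEz z hz)
    simpa [f] using h
  · rintro _ ⟨⟨⟨x, hx⟩, hxk⟩, rfl⟩
    have h0 := hker ⟨⟨x, hx⟩, hxk⟩
    obtain ⟨z, hz, rfl⟩ := (hR _).mp hx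
    have hdvd : ∀ i, (p : ℤ) ∣ z (Sum.inl i) := fun i =>
      (ZMod.intCast_zmod_eq_zero_iff_dvd _ _).mp (h0 i)
    choose y hy using hdvd
    have h := hEz z hz
    have h1 : (p : ℤ) * (p * ∑ i, u i * y i ^ 2 + ∑ j, w j * z (Sum.inr j) ^ 2) = 0 := by
      rw [← h, mul_add, ← mul_assoc, Finset.mul_sum]
      congr 1
      refine Finset.sum_congr rfl fun i _ => ?_
      rw [hy]
      ring
    have h2 := congrArg (Int.cast : ℤ → ZMod p) ((mul_eq_zero.mp h1).resolve_left hp)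
    simpa [g] using h2
  · rw [LinearMap.finrank_range_of_inj hg, LinearMap.finrank_range_add_finrank_ker f]
    exact hdim

open Module in
/-- A rational diagonal form of odd dimension with a totally isotropic subspace of maximal
dimension: the residue form of even dimension has square discriminant, up to sign. -/
theorem isSquare_prod_residue {ι : Type*} [Fintype ι] (p : ℕ) [Fact p.Prime]
    (hp2 : p ≠ 2) (e : ι → ℕ) (u : ι → ℤ) (hu : ∀ i, ¬ (p : ℤ) ∣ u i) (E : Submodule ℚ (ι → ℚ))
    (hE : ∀ x ∈ E, ∑ i, (p : ℚ) ^ e i * u i * x i ^ 2 = 0)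
    (hdim : Fintype.card ι = 2 * finrank ℚ E + 1) (r : ℕ)
    (hr : Even (Finset.univ.filter fun i => e i % 2 = r % 2).card) :
    IsSquare (∏ i with e i % 2 = r % 2, (u i : ZMod p)) ∨
      IsSquare (-∏ i with e i % 2 = r % 2, (u i : ZMod p)) := by
  classical
  have hp : (p : ℚ) ≠ 0 := by exact_mod_cast (Fact.out : p.Prime).ne_zero
  have h2 : (2 : ZMod p) ≠ 0 := by
    have := (ZMod.prime_ne_zero p 2 hp2)
    exact_mod_cast this
  have hu' : ∀ i, (u i : ZMod p) ≠ 0 := fun i h =>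
    hu i ((ZMod.intCast_zmod_eq_zero_iff_dvd _ _).mp h)
  let I := {i // e i % 2 = 0}
  let J := {i // e i % 2 = 1}
  let φ : (ι → ℚ) →ₗ[ℚ] (I ⊕ J → ℚ) :=
    { toFun := fun x => Sum.elim (fun i => p ^ (e i / 2) * x i) (fun i => p ^ (e i / 2) * x i)
      map_add' := fun x y => by
        ext i
        rcases i with i | i <;> simp [mul_add]
      map_smul' := fun a x => by
        ext i
        rcases i with i | i <;> simp [mul_left_comm] }
  have hφ : Function.Injective φ := by
    intro x y hxy
    ext i
    rcases Nat.mod_two_eq_zero_or_one (e i) with h | h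
    · have := congrFun hxy (Sum.inl ⟨i, h⟩)
      simpa [φ, hp] using this
    · have := congrFun hxy (Sum.inr ⟨i, h⟩)
      simpa [φ, hp] using this
  have hsplit : ∀ F : ι → ℚ, ∑ i, F i = ∑ i : I, F i + ∑ j : J, F j := fun F => by
    rw [← Finset.sum_filter_add_sum_filter_not Finset.univ (fun i => e i % 2 = 0) F]
    congr 1
    · exact (Finset.sum_subtype _ (by simp) F)
    · exact (Finset.sum_subtype _ (by simp) F)
  obtain ⟨P, K, hP, hK, hPK⟩ := exists_isotropic_residues p (fun i : I => u i) (fun j : J => u j)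
    (E.map φ) (by
      rintro _ ⟨x, hx, rfl⟩
      rw [← hE x hx, hsplit, Finset.mul_sum]
      congr 1
      · refine Finset.sum_congr rfl fun i _ => ?_
        have : (p : ℚ) ^ e i = (p ^ (e i / 2)) ^ 2 := by
          rw [← pow_mul]
          congr 1
          have := i.2
          omega
        simp only [φ, LinearMap.coe_mk, AddHom.coe_mk, Sum.elim_inl, this]
        ring
      · refine Finset.sum_congr rfl fun i _ => ?_
        have : (p : ℚ) ^ e i = p * (p ^ (e i / 2)) ^ 2 := by
          rw [← pow_mul, ← pow_succ']
          congr 1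
          have := i.2
          omega
        simp only [φ, LinearMap.coe_mk, AddHom.coe_mk, Sum.elim_inr, this]
        ring)
  rw [← (E.equivMapOfInjective φ hφ).finrank_eq] at hPK
  have hPle := two_mul_finrank_le_of_isotropic h2 _ (fun i : I => hu' i) P hP
  have hKle := two_mul_finrank_le_of_isotropic h2 _ (fun j : J => hu' j) K hK
  have hcard : Fintype.card ι = Fintype.card I + Fintype.card J := by
    have := hsplit fun _ => 1
    simp only [Finset.sum_const, Finset.card_univ, nsmul_eq_mul, mul_one] at this
    exact_mod_cast this
  have hPsq := fun q (hq : Fintype.card I = q + q) =>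
    isSquare_prod_of_isotropic h2 (fun i : I => (u i : ZMod p)) P hP (by omega)
  have hKsq := fun q (hq : Fintype.card J = q + q) =>
    isSquare_prod_of_isotropic h2 (fun j : J => (u j : ZMod p)) K hK (by omega)
  rcases Nat.mod_two_eq_zero_or_one r with h | h <;> rw [h] at hr ⊢ <;>
    rw [← Fintype.card_subtype] at hr <;> obtain ⟨q, hq⟩ := hr
  · rw [Finset.prod_subtype (p := fun i => e i % 2 = 0) _ (by simp)]
    exact hPsq q ((Fintype.card_congr (Equiv.refl _)).trans hq)
  · rw [Finset.prod_subtype (p := fun i => e i % 2 = 1) _ (by simp)]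
    exact hKsq q ((Fintype.card_congr (Equiv.refl _)).trans hq)


namespace BlockCovering

variable {v k lam : ℕ} {V β : Type*} [Fintype V] [DecidableEq V] [Fintype β]

theorem sum_sq_sum_block (C : BlockCovering v k lam V β) (X : V → ℚ) :
    ∑ j, (∑ x ∈ C.block j, X x) ^ 2 = ∑ x, ∑ y, (C.pairCount x y : ℚ) * (X x * X y) := by
  have h1 : ∀ j, (∑ x ∈ C.block j, X x) ^ 2
      = ∑ x, ∑ y, if x ∈ C.block j ∧ y ∈ C.block j then X x * X y else 0 := fun j => by
    have h : ∑ x ∈ C.block j, X x = ∑ x, if x ∈ C.block j then X x else 0 := by simp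
    rw [h, sq, Finset.sum_mul_sum]
    refine Finset.sum_congr rfl fun x _ => Finset.sum_congr rfl fun y _ => ?_
    by_cases hx : x ∈ C.block j <;> by_cases hy : y ∈ C.block j <;> simp [hx, hy]
  simp_rw [h1]
  rw [Finset.sum_comm]
  refine Finset.sum_congr rfl fun x _ => ?_
  rw [Finset.sum_comm]
  refine Finset.sum_congr rfl fun y _ => ?_
  rw [← Finset.sum_filter, Finset.sum_const, nsmul_eq_mul, pairCount]

theorem sum_pairCount (C : BlockCovering v k lam V β) (x : V) :
    ∑ y, C.pairCount x y = k * C.pairCount x x := by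
  simp only [pairCount, Finset.card_filter, and_self]
  rw [Finset.sum_comm, Finset.mul_sum]
  refine Finset.sum_congr rfl fun j _ => ?_
  by_cases hx : x ∈ C.block j <;> simp [hx, C.card_block]

theorem pairCount_eq (C : BlockCovering v k lam V β) (x y : V) :
    (C.pairCount x y : ℤ) = lam + C.excess.mult x y
      + if x = y then (C.pairCount x x : ℤ) - lam else 0 := by
  by_cases h : x = y
  · subst h
    simp [C.excess.loopless]
  · have h1 : lam ≤ C.pairCount x y := C.covers x y h
    simp only [excess, h, if_false]
    push_cast [h1]
    ring

/-- If all vertices have degree `d` in the excess, then every point lies in the same number of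
blocks. -/
theorem pairCount_self_of_degree (C : BlockCovering v k lam V β) {d : ℕ} (hk : 1 < k)
    (hdeg : ∀ x, ∑ y, C.excess.mult x y = d) (hv : (lam : ℤ) * (v - 1) + d = k * (k - 1)) (x : V) :
    C.pairCount x x = k := by
  have h1 : ∑ y, (C.pairCount x y : ℤ) = k * C.pairCount x x := by
    exact_mod_cast C.sum_pairCount x
  have h2 : ∑ y, (C.excess.mult x y : ℤ) = d := by exact_mod_cast hdeg x
  rw [Finset.sum_congr rfl fun y _ => C.pairCount_eq x y] at h1
  rw [Finset.sum_add_distrib, Finset.sum_add_distrib, h2] at h1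
  simp only [Finset.sum_const, Finset.card_univ, C.card_points, nsmul_eq_mul, Finset.sum_ite_eq,
    Finset.mem_univ, if_true] at h1
  have h3 : ((k : ℤ) - 1) * (C.pairCount x x - k) = 0 := by linear_combination hv - h1
  have h4 : (k : ℤ) - 1 ≠ 0 := by omega
  have h5 := (mul_eq_zero.mp h3).resolve_left h4
  omega

theorem sum_sq_sum_block_of_pairCount_self (C : BlockCovering v k lam V β)
    (hr : ∀ x, C.pairCount x x = k) (X : V → ℚ) :
    ∑ j, (∑ x ∈ C.block j, X x) ^ 2 = lam * (∑ x, X x) ^ 2 + ((k : ℚ) - lam) * ∑ x, X x ^ 2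
      + ∑ x, ∑ y, (C.excess.mult x y : ℚ) * (X x * X y) := by
  have h1 : ∀ x y, (C.pairCount x y : ℚ) * (X x * X y) = lam * (X x * X y)
      + (if x = y then ((k : ℚ) - lam) * (X x * X y) else 0)
      + C.excess.mult x y * (X x * X y) := fun x y => by
    have h : (C.pairCount x y : ℚ) = ((C.pairCount x y : ℤ) : ℚ) := by simp
    rw [h, C.pairCount_eq x y, hr]
    by_cases hxy : x = y
    · simp only [hxy, if_true]
      push_cast
      ring
    · simp only [hxy, if_false]
      push_cast
      ring
  rw [C.sum_sq_sum_block]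
  simp_rw [h1, Finset.sum_add_distrib, ← Finset.mul_sum]
  rw [sq, Finset.sum_mul, Finset.mul_sum]
  simp only [Finset.sum_ite_eq, Finset.mem_univ, if_true, Finset.mul_sum, sq]

end BlockCovering

namespace LooplessMultigraph

theorem sum_disjointCycles {I M : Type*} [Fintype I] [DecidableEq I] [Semiring M] (c : I → ℕ)
    (i : I) (a : Fin (c i)) (f : (Σ i, Fin (c i)) → M) :
    ∑ q, ((disjointCycles c).mult ⟨i, a⟩ q : M) * f q
      = ∑ b : Fin (c i), (cycleMult (c i) a b : M) * f ⟨i, b⟩ := by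
  rw [Fintype.sum_sigma, Finset.sum_eq_single i]
  · simp [disjointCycles]
  · intro j _ hj
    simp [disjointCycles, hj.symm]
  · simp

/-- The cycle lengths of the disjoint union of `t₂` cycles of length `2` and `t₃` cycles of
length `3`. -/
abbrev twoThree (t₂ t₃ : ℕ) : Fin t₂ ⊕ Fin t₃ → ℕ :=
  Sum.elim (fun _ => 2) (fun _ => 3)

abbrev TwoThreePoint (t₂ t₃ : ℕ) : Type := Σ i, Fin (twoThree t₂ t₃ i)

variable {t₂ t₃ : ℕ}

/-- The points of the cycles of length `2`. -/
abbrev twoPt (i : Fin t₂) (a : Fin 2) : TwoThreePoint t₂ t₃ := ⟨Sum.inl i, a⟩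

/-- The points of the cycles of length `3`. -/
abbrev threePt (i : Fin t₃) (a : Fin 3) : TwoThreePoint t₂ t₃ := ⟨Sum.inr i, a⟩

theorem sum_twoThree {M : Type*} [AddCommMonoid M] (f : TwoThreePoint t₂ t₃ → M) :
    ∑ q, f q = ∑ i, (f (twoPt i 0) + f (twoPt i 1))
      + ∑ i, (f (threePt i 0) + f (threePt i 1) + f (threePt i 2)) := by
  rw [Fintype.sum_sigma, Fintype.sum_sum_type]
  congr 1
  · exact Finset.sum_congr rfl fun i _ => Fin.sum_univ_two fun a => f (twoPt i a)
  · exact Finset.sum_congr rfl fun i _ => Fin.sum_univ_three fun a => f (threePt i a)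

theorem sum_mult_twoPt {M : Type*} [Semiring M] (i : Fin t₂) (a : Fin 2)
    (f : TwoThreePoint t₂ t₃ → M) :
    ∑ q, ((disjointCycles (twoThree t₂ t₃)).mult (twoPt i a) q : M) * f q
      = 2 * f (twoPt i (1 - a)) := by
  refine (sum_disjointCycles (twoThree t₂ t₃) (Sum.inl i) a f).trans ?_
  refine (Fin.sum_univ_two fun b : Fin 2 => (cycleMult 2 a b : M) * f (twoPt i b)).trans ?_
  fin_cases a <;> simp [cycleMult, one_add_one_eq_two]

theorem sum_mult_threePt {M : Type*} [Semiring M] (i : Fin t₃) (a : Fin 3)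
    (f : TwoThreePoint t₂ t₃ → M) :
    ∑ q, ((disjointCycles (twoThree t₂ t₃)).mult (threePt i a) q : M) * f q
      = f (threePt i (a + 1)) + f (threePt i (a + 2)) := by
  refine (sum_disjointCycles (twoThree t₂ t₃) (Sum.inr i) a f).trans ?_
  refine (Fin.sum_univ_three fun b : Fin 3 => (cycleMult 3 a b : M) * f (threePt i b)).trans ?_
  fin_cases a <;> simp [cycleMult, add_comm]

theorem sum_mult_eq_two (p : TwoThreePoint t₂ t₃) :
    ∑ q, (disjointCycles (twoThree t₂ t₃)).mult p q = 2 := by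
  obtain ⟨i | i, a⟩ := p
  · simpa using sum_mult_twoPt (M := ℕ) i a fun _ => 1
  · simpa using sum_mult_threePt (M := ℕ) i a fun _ => 1

/-- Diagonalization of the form `n I + A`, where `A` is the adjacency matrix of a disjoint union of
cycles of lengths `2` and `3`. -/
theorem diagonalization_twoThree (n : ℚ) (Y : TwoThreePoint t₂ t₃ → ℚ) :
    6 * (n * ∑ p, Y p ^ 2
      + ∑ p, ∑ q, ((disjointCycles (twoThree t₂ t₃)).mult p q : ℚ) * (Y p * Y q)) =
    (∑ i, (n + 2) * 3 * (Y (twoPt i 0) + Y (twoPt i 1)) ^ 2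
      + ∑ i, (n + 2) * 2 * (Y (threePt i 0) + Y (threePt i 1) + Y (threePt i 2)) ^ 2)
    + (∑ i, (n - 2) * 3 * (Y (twoPt i 0) - Y (twoPt i 1)) ^ 2
      + (∑ i, (n - 1) * 3 * (Y (threePt i 0) - Y (threePt i 1)) ^ 2
        + ∑ i, (n - 1) * (Y (threePt i 0) + Y (threePt i 1) - 2 * Y (threePt i 2)) ^ 2)) := by
  have h : ∀ p, ∑ q, ((disjointCycles (twoThree t₂ t₃)).mult p q : ℚ) * (Y p * Y q)
      = Y p * ∑ q, ((disjointCycles (twoThree t₂ t₃)).mult p q : ℚ) * Y q := fun p => by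
    rw [Finset.mul_sum]
    exact Finset.sum_congr rfl fun q _ => by ring
  simp_rw [h]
  rw [Finset.mul_sum, ← Finset.sum_add_distrib, sum_twoThree, mul_add]
  simp only [sum_mult_twoPt, sum_mult_threePt, Finset.mul_sum]
  rw [add_add_add_comm (∑ i, _) _ (∑ i, _) _, ← Finset.sum_add_distrib,
    ← Finset.sum_add_distrib, ← Finset.sum_add_distrib]
  congr 1
  · refine Finset.sum_congr rfl fun i _ => ?_
    rw [sub_zero, sub_self]
    ring
  · refine Finset.sum_congr rfl fun i _ => ?_
    have h1 : (1 : Fin 3) + 1 = 2 := rfl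
    have h2 : (1 : Fin 3) + 2 = 0 := rfl
    have h3 : (2 : Fin 3) + 1 = 0 := rfl
    have h4 : (2 : Fin 3) + 2 = 1 := rfl
    rw [zero_add, zero_add, h1, h2, h3, h4]
    ring

end LooplessMultigraph


namespace LooplessMultigraph

variable {t₂ t₃ : ℕ}

/-- The index set of a diagonal form in `2 v + 1` variables, where `v` is the number of points:
one for each block, one for the sum of all coordinates, and one for each basis vector of an
eigenspace of `A`. -/
abbrev DiagIndex (β : Type*) (t₂ t₃ : ℕ) : Type _ :=
  β ⊕ (Unit ⊕ ((Fin t₂ ⊕ Fin t₃) ⊕ (Fin t₂ ⊕ (Fin t₃ ⊕ Fin t₃))))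

/-- The coordinates of the diagonal form as functions of the coordinates of the points. -/
def diagMap {β : Type*} (f : (TwoThreePoint t₂ t₃ → ℚ) →ₗ[ℚ] (β → ℚ)) :
    (TwoThreePoint t₂ t₃ → ℚ) →ₗ[ℚ] (DiagIndex β t₂ t₃ → ℚ) where
  toFun Y := Sum.elim (f Y) (Sum.elim (fun _ => ∑ p, Y p)
    (Sum.elim
      (Sum.elim (fun i => Y (twoPt i 0) + Y (twoPt i 1))
        (fun i => Y (threePt i 0) + Y (threePt i 1) + Y (threePt i 2)))
      (Sum.elim (fun i => Y (twoPt i 0) - Y (twoPt i 1))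
        (Sum.elim (fun i => Y (threePt i 0) - Y (threePt i 1))
          (fun i => Y (threePt i 0) + Y (threePt i 1) - 2 * Y (threePt i 2))))))
  map_add' Y Z := by
    ext i
    rcases i with i | i | (i | i) | i | i | i <;>
      simp only [map_add, Pi.add_apply, Sum.elim_inl, Sum.elim_inr, Finset.sum_add_distrib] <;> ring
  map_smul' a Y := by
    ext i
    rcases i with i | i | (i | i) | i | i | i <;>
      simp only [map_smul, Pi.smul_apply, smul_eq_mul, Sum.elim_inl, Sum.elim_inr, Finset.mul_sum,
        RingHom.id_apply] <;> ring

theorem diagMap_injective {β : Type*} (f : (TwoThreePoint t₂ t₃ → ℚ) →ₗ[ℚ] (β → ℚ)) :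
    Function.Injective (diagMap f) := by
  rw [injective_iff_map_eq_zero]
  intro Y hY
  have h1 : ∀ i, Y (twoPt i 0) + Y (twoPt i 1) = 0 := fun i =>
    congrFun hY (Sum.inr (Sum.inr (Sum.inl (Sum.inl i))))
  have h2 : ∀ i, Y (threePt i 0) + Y (threePt i 1) + Y (threePt i 2) = 0 := fun i =>
    congrFun hY (Sum.inr (Sum.inr (Sum.inl (Sum.inr i))))
  have h3 : ∀ i, Y (twoPt i 0) - Y (twoPt i 1) = 0 := fun i =>
    congrFun hY (Sum.inr (Sum.inr (Sum.inr (Sum.inl i))))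
  have h4 : ∀ i, Y (threePt i 0) - Y (threePt i 1) = 0 := fun i =>
    congrFun hY (Sum.inr (Sum.inr (Sum.inr (Sum.inr (Sum.inl i)))))
  have h5 : ∀ i, Y (threePt i 0) + Y (threePt i 1) - 2 * Y (threePt i 2) = 0 := fun i =>
    congrFun hY (Sum.inr (Sum.inr (Sum.inr (Sum.inr (Sum.inr i)))))
  have h6 : ∀ (i : Fin t₂) (a : Fin 2), Y (twoPt i a) = 0 := fun i a => by
    match a with
    | 0 => linarith [h1 i, h3 i]
    | 1 => linarith [h1 i, h3 i]
  have h7 : ∀ (i : Fin t₃) (a : Fin 3), Y (threePt i a) = 0 := fun i a => by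
    match a with
    | 0 => linarith [h2 i, h4 i, h5 i]
    | 1 => linarith [h2 i, h4 i, h5 i]
    | 2 => linarith [h2 i, h4 i, h5 i]
  ext ⟨i | i, a⟩
  · exact h6 i a
  · exact h7 i a

instance factPrimeFive : Fact (Nat.Prime 5) := ⟨by norm_num⟩

/-- The quadratic character modulo `5`. -/
abbrev charFive : MulChar (ZMod 5) ℤ := quadraticChar (ZMod 5)

theorem charFive_two : charFive 2 = -1 := by decide

theorem charFive_three : charFive 3 = -1 := by decide

theorem charFive_four : charFive 4 = 1 := by decide

theorem charFive_neg (x : ZMod 5) : charFive (-x) = charFive x := by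
  revert x
  decide

theorem charFive_intCast_congr {a b : ℤ} (h : (5 : ℤ) ∣ b - a) :
    charFive (a : ZMod 5) = charFive (b : ZMod 5) := by
  rw [(ZMod.intCast_eq_intCast_iff_dvd_sub a b 5).mpr h]

theorem charFive_sq {a : ℤ} (h : ¬ (5 : ℤ) ∣ a) : charFive (a : ZMod 5) ^ 2 = 1 :=
  quadraticChar_sq_one fun h' => h ((ZMod.intCast_zmod_eq_zero_iff_dvd _ _).mp h')

@[to_additive]
theorem prod_ite_sumElim_mod {α β M : Type*} [Fintype α] [Fintype β] [CommMonoid M] (a : α → ℕ)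
    (b : β → ℕ) (q s : ℕ) (f : α ⊕ β → M) :
    ∏ i, (if Sum.elim a b i % q = s then f i else 1)
      = (∏ i, if a i % q = s then f (Sum.inl i) else 1)
        * ∏ i, if b i % q = s then f (Sum.inr i) else 1 :=
  Fintype.prod_sum_type _

/-- Let the form with matrix `n I + A + lam J`, where `A` is the adjacency matrix of a disjoint
union of cycles of lengths `2` and `3`, be a sum of squares, as many as there are points. Then the
residue forms modulo `5` satisfy a product formula for the quadratic character. -/
theorem charFive_residue {β : Type*} [Fintype β]
    (hβ : Fintype.card β = 2 * t₂ + 3 * t₃) (n lam : ℤ) (hlam : ¬ (5 : ℤ) ∣ lam)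
    (f : (TwoThreePoint t₂ t₃ → ℚ) →ₗ[ℚ] (β → ℚ))
    (hf : ∀ Y, ∑ j, f Y j ^ 2 = lam * (∑ p, Y p) ^ 2 + (n * ∑ p, Y p ^ 2
      + ∑ p, ∑ q, ((disjointCycles (twoThree t₂ t₃)).mult p q : ℚ) * (Y p * Y q)))
    (e₀ e₁ e₂ : ℕ) (u₀ u₁ u₂ : ℤ) (h₀ : n + 2 = 5 ^ e₀ * u₀) (h₁ : n - 2 = 5 ^ e₁ * u₁)
    (h₂ : n - 1 = 5 ^ e₂ * u₂) (hu₀ : ¬ (5 : ℤ) ∣ u₀) (hu₁ : ¬ (5 : ℤ) ∣ u₁)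
    (hu₂ : ¬ (5 : ℤ) ∣ u₂) (r : ℕ)
    (hr : Even ((if 0 = r % 2 then 2 * t₂ + 3 * t₃ + 1 else 0)
      + (if e₀ % 2 = r % 2 then t₂ + t₃ else 0) + (if e₁ % 2 = r % 2 then t₂ else 0)
      + (if e₂ % 2 = r % 2 then 2 * t₃ else 0))) :
    (if 0 = r % 2 then charFive lam else 1) *
      (if e₀ % 2 = r % 2 then (-charFive u₀) ^ (t₂ + t₃) else 1) *
      (if e₁ % 2 = r % 2 then (-charFive u₁) ^ t₂ else 1) *
      (if e₂ % 2 = r % 2 then (-1) ^ t₃ else 1) = 1 := by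
  classical
  let e : DiagIndex β t₂ t₃ → ℕ := Sum.elim (fun _ => 0) (Sum.elim (fun _ => 0)
    (Sum.elim (Sum.elim (fun _ => e₀) (fun _ => e₀))
      (Sum.elim (fun _ => e₁) (Sum.elim (fun _ => e₂) (fun _ => e₂)))))
  let u : DiagIndex β t₂ t₃ → ℤ := Sum.elim (fun _ => -6) (Sum.elim (fun _ => 6 * lam)
    (Sum.elim (Sum.elim (fun _ => 3 * u₀) (fun _ => 2 * u₀))
      (Sum.elim (fun _ => 3 * u₁) (Sum.elim (fun _ => 3 * u₂) (fun _ => u₂)))))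
  have hu : ∀ i, ¬ ((5 : ℕ) : ℤ) ∣ u i := by
    rintro (i | i | (i | i) | i | i | i) <;> simp only [u, Sum.elim_inl, Sum.elim_inr] <;> omega
  have hcardP : Fintype.card (TwoThreePoint t₂ t₃) = 2 * t₂ + 3 * t₃ := by
    simp [twoThree, mul_comm]
  have hmain := isSquare_prod_residue 5 (by norm_num) e u hu (LinearMap.range (diagMap f)) (by
      rintro _ ⟨Y, rfl⟩
      have hd := diagonalization_twoThree (n : ℚ) Y
      have h₀' : (n : ℚ) + 2 = 5 ^ e₀ * u₀ := by exact_mod_cast h₀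
      have h₁' : (n : ℚ) - 2 = 5 ^ e₁ * u₁ := by exact_mod_cast h₁
      have h₂' : (n : ℚ) - 1 = 5 ^ e₂ * u₂ := by exact_mod_cast h₂
      rw [h₀', h₁', h₂'] at hd
      have hs : ∑ j, -6 * f Y j ^ 2 = -6 * ∑ j, f Y j ^ 2 := by rw [Finset.mul_sum]
      simp only [Fintype.sum_sum_type, e, u, diagMap, LinearMap.coe_mk, AddHom.coe_mk,
        Sum.elim_inl, Sum.elim_inr, Finset.univ_unique, Finset.sum_singleton, pow_zero, one_mul]
      push_cast
      rw [hs, hf Y]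
      simp only [← mul_assoc, mul_right_comm _ _ (3 : ℚ), mul_right_comm _ _ (2 : ℚ)] at hd ⊢
      linear_combination -hd) (by
      rw [LinearMap.finrank_range_of_inj (diagMap_injective f),
        Module.finrank_fintype_fun_eq_card, hcardP]
      simp only [Fintype.card_sum, Fintype.card_fin, Fintype.card_unit, hβ]
      ring) r (by
      rw [Finset.card_filter]
      convert hr using 1
      simp only [e, sum_ite_sumElim_mod, Finset.sum_const, Finset.card_univ,
        Fintype.card_fin, Fintype.card_unit, hβ, smul_eq_mul, Nat.zero_mod]
      split_ifs <;> ring)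
  set D : ZMod 5 := ∏ i with e i % 2 = r % 2, (u i : ZMod 5) with hD
  have hne : D ≠ 0 := Finset.prod_ne_zero_iff.mpr fun i _ h =>
    hu i ((ZMod.intCast_zmod_eq_zero_iff_dvd _ _).mp h)
  have hone : charFive D = 1 := by
    rcases hmain with h | h
    · exact (quadraticChar_one_iff_isSquare hne).mpr h
    · rw [← charFive_neg]
      exact (quadraticChar_one_iff_isSquare (neg_ne_zero.mpr hne)).mpr h
  have hprod : ∀ i, charFive (u i) = Sum.elim (fun _ => 1) (Sum.elim (fun _ => charFive lam)
      (Sum.elim (fun _ => -charFive u₀) (Sum.elim (fun _ => -charFive u₁)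
        (Sum.elim (fun _ => -charFive u₂) (fun _ => charFive u₂))))) i := by
    have h6 : charFive 6 = 1 := by decide
    have hn6 : charFive (-6) = 1 := by decide
    rintro (i | i | (i | i) | i | i | i) <;>
      simp only [u, Sum.elim_inl, Sum.elim_inr, Int.cast_mul, Int.cast_neg, Int.cast_ofNat,
        map_mul, h6, hn6, charFive_two, charFive_three, one_mul, neg_one_mul]
  have hlast : (-charFive u₂) ^ t₃ * charFive u₂ ^ t₃ = (-1) ^ t₃ := by
    rw [← mul_pow, neg_mul, ← sq, charFive_sq hu₂]
  rw [hD, map_prod, Finset.prod_filter] at hone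
  simp_rw [hprod] at hone
  refine Eq.trans ?_ hone
  simp only [e, prod_ite_sumElim_mod, Sum.elim_inl, Sum.elim_inr, Finset.prod_const,
    Finset.card_univ, Fintype.card_fin, Fintype.card_unit, Nat.zero_mod, ← hlast, pow_add]
  split_ifs <;> simp only [one_pow, one_mul, mul_one, pow_one, mul_assoc]

end LooplessMultigraph

open LooplessMultigraph in
theorem mainTheorem5 (t₂ t₃ k lam : ℕ)
    (ht₂ : 0 < t₂) (ht₃ : 0 < t₃) (hk : 0 < k) (hlam : 0 < lam)
    (hklam : lam + 2 < k) (h5 : ¬ 5 ∣ lam)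
    (hv : ((2 * t₂ + 3 * t₃ : ℕ) : ℚ) = ((k : ℚ) * ((k : ℚ) - 1) - 2) / (lam : ℚ) + 1)
    (hcases :
      (∃ (α : ℕ) (s : ℤ), Odd α ∧ ¬ 5 ∣ s ∧ (k : ℤ) - lam = 5 ^ α * s + 1 ∧ Odd t₃) ∨
      (∃ (α : ℕ) (s : ℤ), Odd α ∧ ¬ 5 ∣ s ∧ (k : ℤ) - lam = 5 ^ α * s + 2 ∧ Odd t₂ ∧
        (lam ≡ 1 [MOD 5] ∨ lam ≡ 4 [MOD 5])) ∨
      (∃ (α : ℕ) (s : ℤ), Odd α ∧ ¬ 5 ∣ s ∧ (k : ℤ) - lam = 5 ^ α * s - 2 ∧ Odd (t₂ + t₃) ∧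
        (lam ≡ 1 [MOD 5] ∨ lam ≡ 4 [MOD 5])))
    {V β : Type*} [Fintype V] [DecidableEq V] [Fintype β] :
    ¬ ∃ C : BlockCovering (2 * t₂ + 3 * t₃) k lam V β,
      C.IsSymmetric ∧
        C.excess.ConsistsOfCycles
          (Sum.elim (fun _ : Fin t₂ => 2) (fun _ : Fin t₃ => 3) : Fin t₂ ⊕ Fin t₃ → ℕ) := by
  rintro ⟨C, hsymm, -, e, he⟩
  change V ≃ TwoThreePoint t₂ t₃ at e
  have hdeg : ∀ x, ∑ y, C.excess.mult x y = 2 := fun x => by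
    simp_rw [he]
    rw [e.sum_comp fun q => (disjointCycles (twoThree t₂ t₃)).mult (e x) q]
    exact sum_mult_eq_two (e x)
  have hv' : (lam : ℤ) * ((2 * t₂ + 3 * t₃ : ℕ) - 1) + (2 : ℕ) = k * (k - 1) := by
    have hl : (lam : ℚ) ≠ 0 := by exact_mod_cast hlam.ne'
    have h : (lam : ℚ) * ((2 * t₂ + 3 * t₃ : ℕ) - 1) + (2 : ℕ) = k * (k - 1) := by
      rw [hv]
      field_simp
      push_cast
      ring
    exact_mod_cast h
  have hself := C.pairCount_self_of_degree (by omega) hdeg hv'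
  let f : (TwoThreePoint t₂ t₃ → ℚ) →ₗ[ℚ] (β → ℚ) :=
    LinearMap.pi fun j => ∑ x ∈ C.block j, LinearMap.proj (e x)
  have hf : ∀ Y, ∑ j, f Y j ^ 2 = ((lam : ℤ) : ℚ) * (∑ p, Y p) ^ 2
      + (((k : ℤ) - lam : ℤ) * ∑ p, Y p ^ 2
      + ∑ p, ∑ q, ((disjointCycles (twoThree t₂ t₃)).mult p q : ℚ) * (Y p * Y q)) := fun Y => by
    have h := C.sum_sq_sum_block_of_pairCount_self hself (Y ∘ e)
    have h1 : ∀ j, f Y j = ∑ x ∈ C.block j, (Y ∘ e) x := fun j => by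
      simp [f]
    simp_rw [h1, h, he]
    simp only [Function.comp_apply]
    rw [e.sum_comp Y, e.sum_comp fun p => Y p ^ 2, ← e.sum_comp fun p => ∑ q, _]
    simp_rw [← e.sum_comp fun q => _ * (_ * Y q)]
    push_cast
    ring
  have hβ : Fintype.card β = 2 * t₂ + 3 * t₃ := hsymm.trans C.card_points
  have hmain := charFive_residue hβ ((k : ℤ) - lam) lam (by omega) f hf
  have hpow : ∀ α : ℕ, Odd α → ∃ m : ℤ, (5 : ℤ) ^ α = 5 * m := fun α hα => by
    obtain ⟨q, rfl⟩ := hα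
    exact ⟨5 ^ (2 * q), by ring⟩
  have hlam_sq : (lam ≡ 1 [MOD 5] ∨ lam ≡ 4 [MOD 5]) →
      charFive ((lam : ℤ) : ZMod 5) = 1 := fun h => by
    rw [Int.cast_natCast]
    rcases h with h | h
    · rw [(ZMod.natCast_eq_natCast_iff lam 1 5).mpr h, Nat.cast_one, map_one]
    · rw [(ZMod.natCast_eq_natCast_iff lam 4 5).mpr h]
      exact charFive_four
  rcases hcases with ⟨α, s, hα, hs, hn, ht⟩ | ⟨α, s, hα, hs, hn, ht, hl⟩ |
    ⟨α, s, hα, hs, hn, ht, hl⟩ <;>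
    obtain ⟨m, hm⟩ := hpow α hα <;> have hα2 := Nat.odd_iff.mp hα <;>
    rw [hn, hm, mul_assoc] at hmain
  · have h := hmain 0 0 α (5 * (m * s) + 3) (5 * (m * s) - 1) s (by ring) (by ring)
      (by rw [hm]; ring) (by omega) (by omega) hs 1 (by simp [hα2])
    simp [hα2, ht.neg_one_pow] at h
  · have h := hmain 0 α 0 (5 * (m * s) + 4) s (5 * (m * s) + 1) (by ring) (by rw [hm]; ring)
      (by ring) (by omega) hs (by omega) 0 (by
        have := Nat.odd_iff.mp ht
        simp only [hα2, Nat.even_iff]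
        norm_num
        omega)
    have h4 : charFive ((5 * (m * s) + 4 : ℤ) : ZMod 5) = 1 :=
      (charFive_intCast_congr (b := 4) ⟨-(m * s), by ring⟩).trans charFive_four
    rw [hlam_sq hl, h4] at h
    have h' : (-1 : ℤ) ^ (t₂ + t₃) * (-1) ^ t₃ = -1 := by
      rw [← pow_add]
      exact Odd.neg_one_pow (by rw [add_assoc]; exact ht.add_even ⟨t₃, rfl⟩)
    simp [hα2, h'] at h
  · have h := hmain α 0 0 s (5 * (m * s) - 4) (5 * (m * s) - 3) (by rw [hm]; ring) (by ring)
      (by ring) hs (by omega) (by omega) 0 (by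
        have := Nat.odd_iff.mp ht
        simp only [hα2, Nat.even_iff]
        norm_num
        omega)
    have h1 : charFive ((5 * (m * s) - 4 : ℤ) : ZMod 5) = 1 := by
      rw [charFive_intCast_congr (b := 1) ⟨1 - m * s, by ring⟩, Int.cast_one, map_one]
    rw [hlam_sq hl, h1] at h
    have h' : (-1 : ℤ) ^ t₂ * (-1) ^ t₃ = -1 := by
      rw [← pow_add]
      exact ht.neg_one_pow
    simp [hα2, h'] at h
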